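/- Let $\kappa$ be a regular uncountable cardinal, and let $\theta,\chi\le\kappa$ be (possibly finite) cardinals with $\theta\ge 1$. Conventions. $[\kappa]^2=\{(\alpha,\beta)\mid\alpha<\beta<\kappa\}$. For an ordinal $\sigma$, $[\kappa]^\sigma$ is the set of all $a\subseteq\kappa$ of order type $\sigma$. For sets of ordinals $a,b$, $a<b$ means that $\alpha<\beta$ for all $\alpha\in a$ and $\beta\in b$; for a family $\mathcal A$ of sets of ordinals, $[\mathcal A]^2=\{(a,b)\in\mathcal A\times\mathcal A\mid a<b\}$. For a function $f$ on $[\kappa]^2$, $f[a\times b]=\{f(\alpha,\beta)\mid\alpha\in a,\ \beta\in b\}$. * $\mathrm{pl}_1(\kappa,\theta,\chi)$ asserts that there is a function $\mathbf t:[\kappa]^2\to\kappa\times\kappa\times\kappa$ such that: (i) whenever $\mathbf t(\alpha,\beta)=(\tau^*,\alpha^*,\beta^*)$, we have $\tau^*\le\alpha^*\le\alpha<\beta^*\le\beta$; (ii) for every $\sigma<\chi$ and every family $\mathcal A\subseteq[\kappa]^\sigma$ consisting of $\kappa$ many pairwise disjoint sets, there is a stationary $S\subseteq\kappa$ such that for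 all $\alpha^*<\beta^*$ in $S$ and all $\tau^*<\min\{\theta,\alpha^*\}$ there is $(a,b)\in[\mathcal A]^2$ with $\mathbf t[a\times b]=\{(\tau^*,\alpha^*,\beta^*)\}$. * $\mathrm{pr}_1(\kappa,\kappa,\theta,\chi)$ asserts that there is a coloring $c:[\kappa]^2\to\theta$ such that for every $\sigma<\chi$, every family $\mathcal A\subseteq[\kappa]^\sigma$ consisting of $\kappa$ many pairwise disjoint sets, and every $i<\theta$, there is $(a,b)\in[\mathcal A]^2$ with $c[a\times b]=\{i\}$. * $\kappa\nrightarrow[\kappa]^2_\theta$ (resp. $\kappa\nrightarrow[\mathrm{stat}]^2_\theta$) asserts that there is a coloring $c:[\kappa]^2\to\theta$ such that for every cofinal (resp. stationary) $X\subseteq\kappa$ and every $\tau<\theta$ there are $x<y$ in $X$ with $c(x,y)=\tau$. Then each of the following implies that $\mathrm{pr}_1(\kappa,\kappa,\theta,\chi)$ holds: 1. $\mathrm{pl}_1(\kappa,\theta,\chi)$; 2. $\mathrm{pl}_1(\kappa,1,\chi)$ and $\kappa\nrightarrow[\mathrm{stat}]^2_\theta$; 3. $\theta$ is infinite, $\mathrm{pl}_1(\kappa,\mathrm{cf}(\theta),\chi)$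 holds, and $\kappa\nrightarrow[\mathrm{stat}]^2_\eta$ holds for every cardinal $\eta$ with $1\le\eta<\theta$; 4. for some cardinal $\nu\le\kappa$, $\mathrm{pl}_1(\kappa,\nu,\chi)$ holds and there is a nonempty poset $\mathbb P$ that satisfies the $\nu^+$-chain condition (every set of pairwise incompatible conditions has size less than $\nu^+$, where $\nu^+$ is the least cardinal greater than $\nu$) such that $\Vdash_{\mathbb P}\kappa\nrightarrow[\kappa]^2_\theta$. -/

import Mathlib

universe u

open Cardinal Ordinal Order

/-! ### Combinatorial principles on a cardinal

The cardinal `κ`, viewed as the set of ordinals below it, is the well-ordered type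
`κ.ord.ToType`; an element of it is coerced to the ordinal it stands for. A function on `[κ]²` is
represented by a curried function of which only the values at pairs `α < β` are ever used. -/

/-- `a < b` for sets of ordinals: every element of `a` is below every element of `b`. -/
def SetLT {K : Type u} [LT K] (a b : Set K) : Prop :=
  ∀ x ∈ a, ∀ y ∈ b, x < y

/-- `𝒜 ⊆ [κ]^σ` is a family consisting of `κ` many pairwise disjoint sets, where `[κ]^σ` is the
collection of all subsets of `κ` of order type `σ`. -/
def IsDisjointFamily (κ : Cardinal.{u}) (σ : Ordinal.{u}) (𝒜 : Set (Set κ.ord.ToType)) : Prop :=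
  (∀ a ∈ 𝒜, Ordinal.type (fun x y : a => x < y) = σ) ∧ #𝒜 = κ ∧ 𝒜.PairwiseDisjoint id

/-- The principle `pl₁(κ, θ, χ)`. -/
def PL1 (κ θ χ : Cardinal.{u}) : Prop :=
  ∃ t : κ.ord.ToType → κ.ord.ToType → κ.ord.ToType × κ.ord.ToType × κ.ord.ToType,
    (∀ α β τs αs βs, α < β → t α β = (τs, αs, βs) → τs ≤ αs ∧ αs ≤ α ∧ α < βs ∧ βs ≤ β) ∧
    ∀ σ < χ.ord, ∀ 𝒜 : Set (Set κ.ord.ToType), IsDisjointFamily κ σ 𝒜 →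
      ∃ S : Set κ.ord.ToType, IsStationary S ∧
        ∀ αs ∈ S, ∀ βs ∈ S, αs < βs →
          ∀ τs : κ.ord.ToType, (τs : Ordinal.{u}) < min θ.ord (αs : Ordinal.{u}) →
            ∃ a ∈ 𝒜, ∃ b ∈ 𝒜, SetLT a b ∧
              (fun q : κ.ord.ToType × κ.ord.ToType => t q.1 q.2) '' (a ×ˢ b) = {(τs, αs, βs)}

/-- The principle `pr₁(κ, κ, θ, χ)`. -/
def PR1 (κ θ χ : Cardinal.{u}) : Prop :=
  ∃ c : κ.ord.ToType → κ.ord.ToType → θ.ord.ToType,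
    ∀ σ < χ.ord, ∀ 𝒜 : Set (Set κ.ord.ToType), IsDisjointFamily κ σ 𝒜 →
      ∀ i : θ.ord.ToType, ∃ a ∈ 𝒜, ∃ b ∈ 𝒜, SetLT a b ∧
        (fun q : κ.ord.ToType × κ.ord.ToType => c q.1 q.2) '' (a ×ˢ b) = {i}

/-- The negative partition relation `κ ↛ [stat]²_θ`. -/
def NegStatPartition (κ θ : Cardinal.{u}) : Prop :=
  ∃ c : κ.ord.ToType → κ.ord.ToType → θ.ord.ToType,
    ∀ X : Set κ.ord.ToType, IsStationary X →
      ∀ τ : θ.ord.ToType, ∃ x ∈ X, ∃ y ∈ X, x < y ∧ c x y = τ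

/-! ### Forcing -/

/-- The poset `P` satisfies the `μ`-chain condition: every set of pairwise incompatible conditions
has fewer than `μ` elements. -/
def ChainCondition (P : Type u) [Preorder P] (μ : Cardinal.{u}) : Prop :=
  ∀ A : Set P, (∀ p ∈ A, ∀ q ∈ A, p ≠ q → ¬ ∃ r, r ≤ p ∧ r ≤ q) → #A < μ

/-- `P`-names: a `P`-name is a small collection of pairs consisting of a `P`-name and a condition
in `P`. -/
inductive PName (P : Type u) : Type (u + 1)
  | mk (ι : Type u) (name : ι → PName P) (cond : ι → P) : PName P

namespace PName

variable {P : Type u}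

/-- The canonical name for the unordered pair of two names. -/
def pair (x y : PName P) : PName P :=
  mk (Bool × P) (fun i => if i.1 then x else y) (fun i => i.2)

/-- The canonical name for the Kuratowski ordered pair `{{x}, {x, y}}` of two names. -/
def opair (x y : PName P) : PName P :=
  pair (pair x x) (pair x y)

/-- The canonical (check) name for an ordinal of the ground model, identified with the set of its
predecessors. -/
noncomputable def check (P : Type u) (o : Ordinal.{u}) : PName P :=
  mk (o.ToType × P) (fun i => check P (i.1 : Ordinal.{u})) (fun i => i.2)
termination_by o
decreasing_by exact (ToType.toOrd i.1).2

end PName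

/-- A forcing statement over `P`: `φ p` means that `p ⊩ φ`. -/
abbrev FStatement (P : Type u) : Type u := P → Prop

namespace FStatement

variable {P : Type u} [Preorder P]

/-- `p ⊩ x = y`. -/
def eq : PName P → PName P → FStatement P
  | .mk ι x a, .mk ι' y b => fun p =>
    (∀ i : ι, ∀ q ≤ p, q ≤ a i → ∃ r ≤ q, ∃ j : ι', r ≤ b j ∧ eq (x i) (y j) r) ∧
    (∀ j : ι', ∀ q ≤ p, q ≤ b j → ∃ r ≤ q, ∃ i : ι, r ≤ a i ∧ eq (x i) (y j) r)

/-- `p ⊩ x ∈ y`. -/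
def mem (x : PName P) : PName P → FStatement P
  | .mk ι' y b => fun p => ∀ q ≤ p, ∃ r ≤ q, ∃ j : ι', r ≤ b j ∧ eq x (y j) r

/-- `p ⊩ φ ∧ ψ`. -/
def and (φ ψ : FStatement P) : FStatement P := fun p => φ p ∧ ψ p

/-- `p ⊩ φ → ψ`. -/
def imp (φ ψ : FStatement P) : FStatement P := fun p => ∀ q ≤ p, φ q → ψ q

/-- `p ⊩ ∀ x, φ x`, where `x` ranges over all `P`-names. -/
def all (φ : PName P → FStatement P) : FStatement P := fun p => ∀ x, φ x p

/-- `p ⊩ ∃ x, φ x`: the conditions with a witnessing `P`-name are dense below `p`. -/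
def ex (φ : PName P → FStatement P) : FStatement P := fun p => ∀ q ≤ p, ∃ r ≤ q, ∃ x, φ x r

/-- `p ⊩ ∀ x ∈ y, φ x`. -/
def ball (y : PName P) (φ : PName P → FStatement P) : FStatement P :=
  all fun x => imp (mem x y) (φ x)

/-- `p ⊩ ∃ x ∈ y, φ x`. -/
def bex (y : PName P) (φ : PName P → FStatement P) : FStatement P :=
  ex fun x => and (mem x y) (φ x)

/-- `c(x, y) = τ`, that is, `⟨⟨x, y⟩, τ⟩ ∈ c`. -/
def app (c x y τ : PName P) : FStatement P :=
  mem (.opair (.opair x y) τ) c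

/-- `c` is a function from `[k]²` to `t`, where `[k]²` is the set of all pairs `⟨x, y⟩` of elements
of the ordinal `k` with `x ∈ y`. -/
def isColoring (k t c : PName P) : FStatement P :=
  and
    (ball c fun z => bex k fun x => bex k fun y => bex t fun τ =>
      and (mem x y) (eq z (.opair (.opair x y) τ)))
    (and
      (ball k fun x => ball k fun y => imp (mem x y) (bex t fun τ => app c x y τ))
      (all fun x => all fun y => all fun τ => all fun τ' =>
        imp (app c x y τ) (imp (app c x y τ') (eq τ τ'))))

/-- `X` is a cofinal subset of the limit ordinal `k`. -/
def isCofinal (k X : PName P) : FStatement P :=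
  and (ball X fun x => mem x k) (ball k fun x => bex X fun y => mem x y)

/-- The statement `k ↛ [k]²_t`: there is a coloring `c : [k]² → t` such that for every cofinal
`X ⊆ k` and every `τ ∈ t`, there are `x ∈ y` in `X` with `c(x, y) = τ`. -/
def negPartition (k t : PName P) : FStatement P :=
  ex fun c => and (isColoring k t c)
    (all fun X => imp (isCofinal k X)
      (ball t fun τ => bex X fun x => bex X fun y => and (mem x y) (app c x y τ)))

/-- `⊩_P φ`: every condition forces `φ`. -/
def Forced (φ : FStatement P) : Prop := ∀ p, φ p

end FStatement

/-- `⊩_P κ ↛ [κ]²_θ`. -/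
def ForcesNegPartition (P : Type u) [Preorder P] (κ θ : Cardinal.{u}) : Prop :=
  FStatement.Forced (FStatement.negPartition (PName.check P κ.ord) (PName.check P θ.ord))

/-! ### Stationary sets and enumerations -/

/-! Compose the map `t` of `pl₁(κ, ν, χ)` with some `d(τ, α, β)` into `θ`. Since `t` takes a single
prescribed value on a suitable `a × b`, it suffices that on every stationary `S` each color is `d(τ,
α, β)` for some `α < β` in `S` and `τ < min(ν, α)` (`PL1.pr1_of_coloring`). The parameter `τ` lets
`ν` many colorings, or `ν` many guesses at each pair, work at once. In (1) `τ` codes the color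
itself; in (2) it is idle; in (3) it codes a member `j` of a cofinal subset of `θ`, and the `j`th
coloring handles the colors up to `j`. In (4) the `ν⁺`-chain condition leaves at most `ν` possible
values of the forced coloring at each pair of ground-model ordinals, and `τ` picks one of them. -/

theorem IsStationary.inter_Ioi {α : Type u} [LinearOrder α] [NoMaxOrder α] {S : Set α}
    (hS : IsStationary S) (x : α) : IsStationary (S ∩ Set.Ioi x) := by
  intro t ht
  have hclub : IsClub (t ∩ Set.Ioi x) := by
    refine ⟨?_, fun y => ?_⟩
    · intro d hd hd₀ hdir a ha
      refine ⟨ht.dirSupClosed (hd.trans Set.inter_subset_left) hd₀ hdir ha, ?_⟩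
      obtain ⟨z, hz⟩ := hd₀
      exact lt_of_lt_of_le (hd hz).2 (ha.1 hz)
    · obtain ⟨w, hw⟩ := exists_gt (max x y)
      obtain ⟨z, hz, hwz⟩ := ht.isCofinal w
      exact ⟨z, ⟨hz, ((le_max_left x y).trans_lt hw).trans_le hwz⟩,
        ((le_max_right x y).trans hw.le).trans hwz⟩
  obtain ⟨y, hyS, hyt, hxy⟩ := hS hclub
  exact ⟨y, ⟨hyS, hxy⟩, hyt⟩

theorem IsStationary.exists_gt {α : Type u} [LinearOrder α] [NoMaxOrder α] {S : Set α}
    (hS : IsStationary S) (x : α) : ∃ y ∈ S, x < y :=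
  (hS.inter_Ioi x).nonempty

theorem toType_coe_lt_coe {o : Ordinal.{u}} {x y : o.ToType} :
    (x : Ordinal.{u}) < (y : Ordinal.{u}) ↔ x < y := by
  rw [Subtype.coe_lt_coe, OrderIso.lt_iff_lt]

/-- A set of at most `ν ≤ κ` elements is enumerated by the ordinals below `ν`. -/
theorem exists_enumeration {β : Type u} [Nonempty β] {κ ν : Cardinal.{u}} (hν : ν ≤ κ)
    (V : Set β) (hV : #V ≤ ν) :
    ∃ e : κ.ord.ToType → β, ∀ v ∈ V, ∃ τ : κ.ord.ToType, (τ : Ordinal.{u}) < ν.ord ∧ e τ = v := by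
  classical
  have hV' : #V ≤ #ν.ord.ToType := by rwa [mk_ord_toType]
  obtain ⟨f⟩ := hV'
  let g : V → κ.ord.ToType := fun v =>
    ToType.mk ⟨(f v : Ordinal.{u}),
      Set.mem_Iio.2 (lt_of_lt_of_le (ToType.toOrd (f v)).2 (ord_le_ord.2 hν))⟩
  have hg (v : V) : (g v : Ordinal.{u}) = (f v : Ordinal.{u}) := by simp [g, ToType.toOrd]
  have hinj : Function.Injective g := by
    intro v w h
    have h' := (hg v).symm.trans
      ((congrArg (fun x : κ.ord.ToType => (x : Ordinal.{u})) h).trans (hg w))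
    exact f.injective ((ToType.mk.symm).injective (Subtype.ext h'))
  -- Values off the range of `g` are junk.
  refine ⟨Function.extend g Subtype.val fun _ => Classical.arbitrary β, fun v hv =>
    ⟨g ⟨v, hv⟩, ?_, hinj.extend_apply _ _ _⟩⟩
  rw [hg]
  exact (ToType.toOrd (f ⟨v, hv⟩)).2

/-! ### From `pl₁` to `pr₁` -/

theorem PL1.pr1_of_coloring {κ ν θ χ : Cardinal.{u}} (h : PL1 κ ν χ)
    (d : κ.ord.ToType → κ.ord.ToType → κ.ord.ToType → θ.ord.ToType)
    (hd : ∀ S : Set κ.ord.ToType, IsStationary S → ∀ i, ∃ α ∈ S, ∃ β ∈ S, α < β ∧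
      ∃ τ : κ.ord.ToType, (τ : Ordinal.{u}) < min ν.ord (α : Ordinal.{u}) ∧ d τ α β = i) :
    PR1 κ θ χ := by
  obtain ⟨t, -, ht⟩ := h
  refine ⟨fun α β => d (t α β).1 (t α β).2.1 (t α β).2.2, fun σ hσ 𝒜 h𝒜 i => ?_⟩
  obtain ⟨S, hS, hSt⟩ := ht σ hσ 𝒜 h𝒜
  obtain ⟨α, hα, β, hβ, hαβ, τ, hτ, rfl⟩ := hd S hS i
  obtain ⟨a, ha, b, hb, hab, htab⟩ := hSt α hα β hβ hαβ τ hτ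
  refine ⟨a, ha, b, hb, hab, ?_⟩
  rw [← Set.image_image (fun q : κ.ord.ToType × κ.ord.ToType × κ.ord.ToType => d q.1 q.2.1 q.2.2)
    (fun q : κ.ord.ToType × κ.ord.ToType => t q.1 q.2), htab, Set.image_singleton]

theorem PL1.pr1_of_family {κ ν θ χ : Cardinal.{u}} (hκ : ℵ₀ ≤ κ) (h : PL1 κ ν χ) (hν : ν ≤ κ)
    {D : Type u} [Nonempty D] (hD : #D ≤ ν)
    (d : D → κ.ord.ToType → κ.ord.ToType → θ.ord.ToType)
    (hd : ∀ i, ∃ j, ∀ S : Set κ.ord.ToType, IsStationary S →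
      ∃ α ∈ S, ∃ β ∈ S, α < β ∧ d j α β = i) :
    PR1 κ θ χ := by
  have := noMaxOrder hκ
  obtain ⟨e, he⟩ := exists_enumeration hν (Set.univ : Set D) (by simpa using hD)
  refine h.pr1_of_coloring (fun τ => d (e τ)) fun S hS i => ?_
  obtain ⟨j, hj⟩ := hd i
  obtain ⟨τ, hτ, rfl⟩ := he j trivial
  -- Cutting `S` down to its part above `τ` secures `τ < α`.
  obtain ⟨α, hα, β, hβ, hαβ, hi⟩ := hj _ (hS.inter_Ioi τ)
  exact ⟨α, hα.1, β, hβ.1, hαβ, τ, lt_min hτ (toType_coe_lt_coe.2 hα.2), hi⟩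

theorem nonempty_ord_toType {θ : Cardinal.{u}} (hθ : 1 ≤ θ) : Nonempty θ.ord.ToType := by
  rw [← mk_ne_zero_iff, mk_ord_toType]
  exact (zero_lt_one.trans_le hθ).ne'

theorem PL1.pr1_of_le {κ ν θ χ : Cardinal.{u}} (hκ : ℵ₀ ≤ κ) (hθ₀ : 1 ≤ θ) (hθ : θ ≤ ν)
    (hν : ν ≤ κ) (h : PL1 κ ν χ) : PR1 κ θ χ := by
  have := noMaxOrder hκ
  have := nonempty_ord_toType hθ₀
  refine h.pr1_of_family hκ hν (D := θ.ord.ToType) (by rwa [mk_ord_toType]) (fun i _ _ => i)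
    fun i => ⟨i, fun S hS => ?_⟩
  obtain ⟨α, hα⟩ := hS.nonempty
  obtain ⟨β, hβ, hαβ⟩ := hS.exists_gt α
  exact ⟨α, hα, β, hβ, hαβ, rfl⟩

theorem PL1.pr1_of_negStatPartition {κ θ χ : Cardinal.{u}} (hκ : ℵ₀ ≤ κ) (h : PL1 κ 1 χ)
    (hc : NegStatPartition κ θ) : PR1 κ θ χ := by
  obtain ⟨c, hc⟩ := hc
  exact h.pr1_of_family hκ (one_le_aleph0.trans hκ) (D := PUnit) (by simp) (fun _ => c)
    fun i => ⟨⟨⟩, fun S hS => hc S hS i⟩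

theorem PL1.pr1_of_forall_negStatPartition {κ θ χ : Cardinal.{u}} (hκ : ℵ₀ ≤ κ) (hθ : θ ≤ κ)
    (hθ' : ℵ₀ ≤ θ) (h : PL1 κ θ.ord.cof χ)
    (hη : ∀ η : Cardinal.{u}, 1 ≤ η → η < θ → NegStatPartition κ η) : PR1 κ θ χ := by
  have := noMaxOrder hθ'
  have := nonempty_ord_toType (one_le_aleph0.trans hθ')
  obtain ⟨C, hC, hCcard⟩ := Order.exists_cof_eq θ.ord.ToType
  have : Nonempty C := hC.nonempty.to_subtype
  have hd (j : C) : ∃ c : κ.ord.ToType → κ.ord.ToType → θ.ord.ToType,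
      ∀ X : Set κ.ord.ToType, IsStationary X → ∀ i ≤ (j : θ.ord.ToType),
        ∃ x ∈ X, ∃ y ∈ X, x < y ∧ c x y = i := by
    -- Proper initial segments of an infinite cardinal are smaller than it, so `hη` applies to the
    -- set of colors up to `j`.
    have hlt : #(Set.Iic (j : θ.ord.ToType)) < θ := by
      rw [← Order.Iio_succ]
      simpa using Cardinal.mk_Iio_lt (succ (j : θ.ord.ToType)) (by simp)
    have hpos : 1 ≤ #(Set.Iic (j : θ.ord.ToType)) :=
      Cardinal.one_le_iff_ne_zero.2 (mk_ne_zero_iff.2 ⟨⟨j, Set.self_mem_Iic⟩⟩)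
    obtain ⟨c, hc⟩ := hη _ hpos hlt
    obtain ⟨f⟩ := Cardinal.eq.1 (mk_ord_toType #(Set.Iic (j : θ.ord.ToType)))
    refine ⟨fun x y => f (c x y), fun X hX i hi => ?_⟩
    obtain ⟨x, hx, y, hy, hxy, hc⟩ := hc X hX (f.symm ⟨i, hi⟩)
    exact ⟨x, hx, y, hy, hxy, by simp [hc]⟩
  choose c hc using hd
  refine h.pr1_of_family hκ ((cof_ord_le θ).trans hθ) (D := C)
    (by rw [hCcard, Ordinal.cof_toType]) c fun i => ?_
  obtain ⟨j, hj, hij⟩ := hC i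
  exact ⟨⟨j, hj⟩, fun S hS => hc ⟨j, hj⟩ S hS i hij⟩

/-! ### Forcing -/

namespace FStatement

variable {P : Type u} [Preorder P]

/-! ### Monotonicity and congruence of forced equality and membership -/

theorem eq.mono : ∀ {x y : PName P} {p q : P}, eq x y p → q ≤ p → eq x y q
  | .mk _ _ _, .mk _ _ _, _, _, h, hqp => by
    rw [eq] at h ⊢
    exact ⟨fun i r hr => h.1 i r (hr.trans hqp), fun j r hr => h.2 j r (hr.trans hqp)⟩

theorem mem.mono {x : PName P} : ∀ {y : PName P} {p q : P}, mem x y p → q ≤ p → mem x y q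
  | .mk _ _ _, _, _, h, hqp => fun r hr => h r (hr.trans hqp)

theorem eq.refl : ∀ (x : PName P) (p : P), eq x x p
  | .mk ι x a, p => by
    rw [eq]
    exact ⟨fun i q _ hqa => ⟨q, le_rfl, i, hqa, eq.refl (x i) q⟩,
      fun i q _ hqa => ⟨q, le_rfl, i, hqa, eq.refl (x i) q⟩⟩

theorem eq.symm : ∀ {x y : PName P} {p : P}, eq x y p → eq y x p
  | .mk ι x a, .mk ι' y b, p, h => by
    rw [eq] at h ⊢
    refine ⟨fun j q hq hqb => ?_, fun i q hq hqa => ?_⟩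
    · obtain ⟨r, hr, i, hra, he⟩ := h.2 j q hq hqb
      exact ⟨r, hr, i, hra, he.symm⟩
    · obtain ⟨r, hr, j, hrb, he⟩ := h.1 i q hq hqa
      exact ⟨r, hr, j, hrb, he.symm⟩

theorem eq.trans : ∀ {x y z : PName P} {p : P}, eq x y p → eq y z p → eq x z p
  | .mk ι x a, .mk ι' y b, .mk ι'' z c, p, h, h' => by
    rw [eq] at h h' ⊢
    refine ⟨fun i q hq hqa => ?_, fun k q hq hqc => ?_⟩
    · obtain ⟨r, hr, j, hrb, he⟩ := h.1 i q hq hqa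
      obtain ⟨s, hs, k, hsc, he'⟩ := h'.1 j r (hr.trans hq) hrb
      exact ⟨s, hs.trans hr, k, hsc, (he.mono hs).trans he'⟩
    · obtain ⟨r, hr, j, hrb, he⟩ := h'.2 k q hq hqc
      obtain ⟨s, hs, i, hsa, he'⟩ := h.2 j r (hr.trans hq) hrb
      exact ⟨s, hs.trans hr, i, hsa, he'.trans (he.mono hs)⟩

theorem mem.congr_left {x x' : PName P} :
    ∀ {y : PName P} {p : P}, mem x y p → eq x x' p → mem x' y p
  | .mk _ _ _, _, h, he => fun q hq => by
    obtain ⟨r, hr, j, hrb, he'⟩ := h q hq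
    exact ⟨r, hr, j, hrb, (he.symm.mono (hr.trans hq)).trans he'⟩

theorem mem.congr_right {x : PName P} :
    ∀ {y y' : PName P} {p : P}, mem x y p → eq y y' p → mem x y' p
  | .mk _ _ _, .mk _ _ _, _, h, he => fun q hq => by
    obtain ⟨r, hr, j, hrb, he'⟩ := h q hq
    rw [eq] at he
    obtain ⟨s, hs, k, hsc, he''⟩ := he.1 j r (hr.trans hq) hrb
    exact ⟨s, hs.trans hr, k, hsc, (he'.mono hs).trans he''⟩

theorem eq.pair {x x' y y' : PName P} {p : P} (hx : eq x x' p) (hy : eq y y' p) :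
    eq (.pair x y) (.pair x' y') p := by
  rw [PName.pair, PName.pair, eq]
  refine ⟨fun i q hq hqi => ⟨q, le_rfl, i, hqi, ?_⟩, fun i q hq hqi => ⟨q, le_rfl, i, hqi, ?_⟩⟩ <;>
  · obtain ⟨(_ | _), _⟩ := i
    · exact hy.mono hq
    · exact hx.mono hq

theorem eq.opair {x x' y y' : PName P} {p : P} (hx : eq x x' p) (hy : eq y y' p) :
    eq (.opair x y) (.opair x' y') p :=
  (hx.pair hx).pair (hx.pair hy)

theorem app.congr {c x x' y y' τ : PName P} {p : P} (h : app c x y τ p) (hx : eq x x' p)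
    (hy : eq y y' p) : app c x' y' τ p :=
  mem.congr_left h ((hx.opair hy).opair (eq.refl τ p))

/-! ### Check names of ordinals -/

theorem mem_check_iff {x : PName P} {o : Ordinal.{u}} {p : P} :
    mem x (.check P o) p ↔
      ∀ q ≤ p, ∃ r ≤ q, ∃ i : o.ToType, eq x (.check P (i : Ordinal.{u})) r := by
  rw [PName.check, mem]
  refine forall₂_congr fun q _ => exists_congr fun r => and_congr_right fun _ => ?_
  exact ⟨fun ⟨j, _, h⟩ => ⟨j.1, h⟩, fun ⟨i, h⟩ => ⟨(i, r), le_rfl, h⟩⟩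

theorem mem_check_of_lt {a b : Ordinal.{u}} (h : a < b) (p : P) :
    mem (.check P a) (.check P b) p := by
  refine mem_check_iff.2 fun q _ => ⟨q, le_rfl, ToType.mk ⟨a, h⟩, ?_⟩
  simpa [ToType.toOrd] using eq.refl (PName.check P a) q

/-- Equality would put the name of `a` into itself, hence make it equal below some condition to the
name of an `i < a`, against the induction hypothesis. -/
theorem not_eq_check_of_lt (a : Ordinal.{u}) :
    ∀ {b : Ordinal.{u}}, a < b → ∀ p : P, ¬ eq (.check P a) (.check P b) p := by
  induction a using WellFoundedLT.induction with
  | ind a ih =>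
    intro b hab p h
    obtain ⟨r, -, i, hi⟩ := mem_check_iff.1 ((mem_check_of_lt hab p).congr_right h.symm) p le_rfl
    exact ih _ (ToType.toOrd i).2 (ToType.toOrd i).2 r hi.symm

theorem eq_of_eq_check {a b : Ordinal.{u}} {p : P} (h : eq (.check P a) (.check P b) p) :
    a = b := by
  rcases lt_trichotomy a b with hab | hab | hab
  · exact (not_eq_check_of_lt a hab p h).elim
  · exact hab
  · exact (not_eq_check_of_lt b hab p h.symm).elim

theorem lt_of_mem_check {a b : Ordinal.{u}} {p : P} (h : mem (.check P a) (.check P b) p) :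
    a < b := by
  obtain ⟨r, -, i, hi⟩ := mem_check_iff.1 h p le_rfl
  rw [eq_of_eq_check hi]
  exact (ToType.toOrd i).2

end FStatement

/-- The canonical name for a set of ordinals of the ground model. -/
noncomputable def PName.checkSet (P : Type u) {o : Ordinal.{u}} (S : Set o.ToType) : PName P :=
  .mk (S × P) (fun i => .check P ((i.1 : o.ToType) : Ordinal.{u})) fun i => i.2

namespace FStatement

variable {P : Type u} [Preorder P]

theorem mem_checkSet_iff {x : PName P} {o : Ordinal.{u}} {S : Set o.ToType} {p : P} :
    mem x (.checkSet P S) p ↔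
      ∀ q ≤ p, ∃ r ≤ q, ∃ i ∈ S, eq x (.check P (i : Ordinal.{u})) r := by
  rw [PName.checkSet, mem]
  refine forall₂_congr fun q _ => exists_congr fun r => and_congr_right fun _ => ?_
  exact ⟨fun ⟨j, _, h⟩ => ⟨j.1, j.1.2, h⟩, fun ⟨i, hi, h⟩ => ⟨(⟨i, hi⟩, r), le_rfl, h⟩⟩

theorem isCofinal_checkSet {o : Ordinal.{u}} {S : Set o.ToType} (hS : ∀ x, ∃ y ∈ S, x < y)
    (p : P) : isCofinal (.check P o) (.checkSet P S) p := by
  refine ⟨fun x q _ hx => mem_check_iff.2 fun q' hq' => ?_, fun x q _ hx q' hq' => ?_⟩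
  · obtain ⟨r, hr, i, -, hi⟩ := mem_checkSet_iff.1 hx q' hq'
    exact ⟨r, hr, i, hi⟩
  · obtain ⟨r, hr, i, hi⟩ := mem_check_iff.1 hx q' hq'
    obtain ⟨j, hj, hij⟩ := hS i
    refine ⟨r, hr, .check P (j : Ordinal.{u}), mem_checkSet_iff.2 fun s _ =>
      ⟨s, le_rfl, j, hj, eq.refl _ s⟩, ?_⟩
    exact (mem_check_of_lt (toType_coe_lt_coe.2 hij) r).congr_left hi.symm

/-- A name `c` for a function takes at most `ν` values at each pair when `P` satisfies the
`ν⁺`-chain condition. -/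
theorem mk_values_le {ν : Cardinal.{u}} (hP : ChainCondition P (succ ν)) {k t c : PName P} {p : P}
    (hc : isColoring k t c p) (x y : PName P) (o : Ordinal.{u}) :
    #{i : o.ToType | ∃ q ≤ p, app c x y (.check P (i : Ordinal.{u})) q} ≤ ν := by
  set V := {i : o.ToType | ∃ q ≤ p, app c x y (.check P (i : Ordinal.{u})) q}
  choose f hfp hf using fun i : V => i.2
  -- Conditions deciding different values are incompatible, as `p` forces `c` to be single-valued.
  -- So `f` is injective with an antichain as range.
  have hcompat (i j : V) (r : P) (hi : r ≤ f i) (hj : r ≤ f j) : i = j := by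
    have h := hc.2.2 x y _ _ r (hi.trans (hfp i)) (mem.mono (hf i) hi) r le_rfl
      (mem.mono (hf j) hj)
    exact Subtype.ext (ToType.mk.symm.injective (Subtype.ext (eq_of_eq_check h)))
  have hinj : Function.Injective f := fun i j hij =>
    hcompat i j (f i) le_rfl hij.le
  rw [← mk_range_eq f hinj, ← Order.lt_succ_iff]
  refine hP _ ?_
  rintro _ ⟨i, rfl⟩ _ ⟨j, rfl⟩ hne ⟨r, hi, hj⟩
  exact hne (congrArg f (hcompat i j r hi hj))

/-- An unbounded ground-model set stays cofinal in the extension, so the color is forced to occur on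
it. Strengthening the condition decides which `α` and `β` in `S` carry it. -/
theorem exists_app_check {o o' : Ordinal.{u}} {c : PName P} {p : P}
    (hc : all (fun X => imp (isCofinal (.check P o) X)
      (ball (.check P o') fun τ => bex X fun x => bex X fun y => and (mem x y) (app c x y τ))) p)
    {S : Set o.ToType} (hS : ∀ x, ∃ y ∈ S, x < y) (i : o'.ToType) :
    ∃ α ∈ S, ∃ β ∈ S, α < β ∧ ∃ q ≤ p, app c (.check P (α : Ordinal.{u}))
      (.check P (β : Ordinal.{u})) (.check P (i : Ordinal.{u})) q := by
  obtain ⟨q, hq, x, hx, hxy⟩ := hc (.checkSet P S) p le_rfl (isCofinal_checkSet hS p)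
    (.check P (i : Ordinal.{u})) p le_rfl (mem_check_of_lt (ToType.toOrd i).2 p) p le_rfl
  obtain ⟨r, hr, y, hy, hlt, happ⟩ := hxy q le_rfl
  obtain ⟨s, hs, α, hα, hxα⟩ := mem_checkSet_iff.1 hx r hr
  obtain ⟨w, hw, β, hβ, hyβ⟩ := mem_checkSet_iff.1 hy s hs
  have hxα' := hxα.mono hw
  refine ⟨α, hα, β, hβ, ?_, w, ((hw.trans hs).trans hr).trans hq, ?_⟩
  · exact toType_coe_lt_coe.1
      (lt_of_mem_check (((hlt.mono (hw.trans hs)).congr_left hxα').congr_right hyβ))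
  · exact app.congr (mem.mono happ (hw.trans hs)) hxα' hyβ

end FStatement

theorem PL1.pr1_of_forcesNegPartition {κ ν θ χ : Cardinal.{u}} (hκ : ℵ₀ ≤ κ) (hθ₀ : 1 ≤ θ)
    (hθ : θ ≤ κ) (hν : ν ≤ κ) (h : PL1 κ ν χ) {P : Type u} [Preorder P] [Nonempty P]
    (hP : ChainCondition P (succ ν)) (hforce : ForcesNegPartition P κ θ) : PR1 κ θ χ := by
  -- If `ν = κ`, no element of `κ` stands for `ν`, but then `θ ≤ ν` and the first case applies.
  rcases hν.eq_or_lt with rfl | hlt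
  · exact h.pr1_of_le hκ hθ₀ hθ le_rfl
  have := noMaxOrder hκ
  have := nonempty_ord_toType hθ₀
  obtain ⟨p, -, c, hcol, hc⟩ := hforce (Classical.arbitrary P) _ le_rfl
  choose e he using fun α β : κ.ord.ToType => exists_enumeration hν _
    (FStatement.mk_values_le hP hcol (.check P (α : Ordinal.{u})) (.check P (β : Ordinal.{u}))
      θ.ord)
  refine h.pr1_of_coloring (fun τ α β => e α β τ) fun S hS i => ?_
  -- Taking `α` above `ν` makes every index `τ < ν` admissible. This is needed because `τ` is found
  -- only after `α` and `β`.
  let γ : κ.ord.ToType := ToType.mk ⟨ν.ord, ord_lt_ord.2 hlt⟩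
  have hγ : (γ : Ordinal.{u}) = ν.ord := by simp [γ, ToType.toOrd]
  obtain ⟨α, hα, β, hβ, hαβ, q, hq, happ⟩ :=
    FStatement.exists_app_check hc (hS.inter_Ioi γ).exists_gt i
  obtain ⟨τ, hτ, hi⟩ := he α β i ⟨q, hq, happ⟩
  refine ⟨α, hα.1, β, hβ.1, hαβ, τ, lt_min hτ (hτ.trans ?_), hi⟩
  rw [← hγ]
  exact toType_coe_lt_coe.2 hα.2

theorem mainTheorem7 (κ θ χ : Cardinal.{u}) (hκ : κ.IsRegular) (hκ' : ℵ₀ < κ)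
    (hθ₀ : 1 ≤ θ) (hθ : θ ≤ κ) (hχ : χ ≤ κ) :
    (PL1 κ θ χ → PR1 κ θ χ) ∧
    (PL1 κ 1 χ → NegStatPartition κ θ → PR1 κ θ χ) ∧
    (ℵ₀ ≤ θ → PL1 κ θ.ord.cof χ → (∀ η : Cardinal.{u}, 1 ≤ η → η < θ → NegStatPartition κ η) →
      PR1 κ θ χ) ∧
    (∀ ν : Cardinal.{u}, ν ≤ κ → PL1 κ ν χ →
      (∃ (P : Type u) (_ : Preorder P), Nonempty P ∧ ChainCondition P (succ ν) ∧
        ForcesNegPartition P κ θ) →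
      PR1 κ θ χ) := by
  refine ⟨fun h => h.pr1_of_le hκ'.le hθ₀ le_rfl hθ,
    fun h hc => h.pr1_of_negStatPartition hκ'.le hc,
    fun hθ' h hη => h.pr1_of_forall_negStatPartition hκ'.le hθ hθ' hη, ?_⟩
  rintro ν hν h ⟨P, _, _, hP, hforce⟩
  exact h.pr1_of_forcesNegPartition hκ'.le hθ₀ hθ hν hP hforce
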